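/- **Theorem (LDP uniformity testing using private coins).** Let $[k]=\{1,\dots,k\}$, let $\mathbf u$ be the uniform distribution on $[k]$, and let $d_{\rm TV}(\mathbf p,\mathbf q)=\frac12\sum_{x\in[k]}|\mathbf p(x)-\mathbf q(x)|$. For $\rho>0$ and a discrete output alphabet $\mathcal Y$, let $\mathcal W_\rho$ be the set of channels $W\colon[k]\to\mathcal Y$ (for every $x$, $W(\cdot\mid x)$ is a probability distribution on $\mathcal Y$) that are $\rho$-locally differentially private: $W(y\mid x_1)\le e^{\rho}\,W(y\mid x_2)$ for all $x_1,x_2\in[k]$ and $y\in\mathcal Y$. In a private-coin protocol with $n$ players using $\mathcal W_\rho$, the samples $X_1,\dots,X_n$ are i.i.d. from an unknown distribution $\mathbf p$ on $[k]$; player $i$ has a discrete random variable $U_i$, where $U_1,\dots,U_n$ are independent of each other and of the samples; it selects a channel $W_i\in\mathcal W_\rho$ as a function of $U_i$ and sends the output $Y_i$ of $W_i$ on input $X_i$. Given the samples and $U_1,\dots,U_n$, the outputs $Y_1,\dots,Y_n$ are independent. A referee who observes $Y_1,\dots,Y_n$, but not $U_1,\dots,U_n$, outputs a possibly randomized bit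 $T(Y_1,\dots,Y_n)\in\{0,1\}$. The protocol together with $T$ is an $(n,\varepsilon)$-test of uniformity if $$\Pr[T=1]>\tfrac{11}{12}\ \text{ when }\mathbf p=\mathbf u,\qquad \Pr[T=0]>\tfrac{11}{12}\ \text{ whenever } d_{\rm TV}(\mathbf p,\mathbf u)>\varepsilon .$$ The sample complexity of $(k,\varepsilon)$-uniformity testing using $\mathcal W_\rho$ for private-coin protocols is the least $n$ for which an $(n,\varepsilon)$-test of this kind exists ($\infty$ if there is none). For every $\varepsilon_0<1$ there is a constant $c>0$, depending only on $\varepsilon_0$, such that for every discrete alphabet $\mathcal Y$, every $k\ge 1$, every $\rho\in(0,1]$ and every $\varepsilon$ with $0<\varepsilon\le\varepsilon_0$ and $\varepsilon<1-\frac1k$, this sample complexity is at least $$c\cdot\frac{k^{3/2}}{\rho^2\varepsilon^2}.$$ -/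

import Mathlib

open scoped ENNReal

/-- The law of `(Z 0, …, Z (n-1))` for independent `Z i ∼ q i`. -/
noncomputable def PMF.independent {α : Type*} : {n : ℕ} → (Fin n → PMF α) → PMF (Fin n → α)
  | 0, _ => PMF.pure Fin.elim0
  | n + 1, q => (q 0).bind fun a =>
      (PMF.independent fun i : Fin n => q i.succ).map fun t => Fin.cons a t

/-- The law of independent variables is the product of the marginals. -/
theorem PMF.independent_apply {α : Type*} {n : ℕ} (q : Fin n → PMF α) (z : Fin n → α) :
    PMF.independent q z = ∏ i, q i (z i) := by
  induction n with
  | zero => simp [PMF.independent, PMF.pure_apply, Subsingleton.elim z Fin.elim0]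
  | succ n ih =>
    rw [PMF.independent, PMF.bind_apply, Fin.prod_univ_succ, tsum_eq_single (z 0)]
    · congr 1
      rw [PMF.map_apply, tsum_eq_single (Fin.tail z)]
      · rw [if_pos (Fin.cons_self_tail z).symm, ih]; rfl
      · intro t ht
        rw [if_neg]
        intro h
        exact ht (by rw [h, Fin.tail_cons])
    · intro a ha
      have h0 : ((PMF.independent fun i : Fin n => q i.succ).map
          fun t => (Fin.cons a t : Fin (n + 1) → α)) z = 0 := by
        rw [PMF.map_apply, ENNReal.tsum_eq_zero]
        intro t
        rw [if_neg]
        intro h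
        exact ha (by rw [h, Fin.cons_zero])
      rw [h0, mul_zero]

/-- Total variation distance of two probability distributions on a finite set. -/
noncomputable def tvDist {α : Type*} [Fintype α] (p q : PMF α) : ℝ :=
  (1 / 2) * ∑ x, |(p x).toReal - (q x).toReal|

/-- A channel from `[k]` to the discrete alphabet `𝒴`; `W x y` is `W(y ∣ x)`. -/
abbrev Channel (k : ℕ) (𝒴 : Type*) := Fin k → PMF 𝒴

/-- The `ρ`-locally differentially private channels:
`W(y ∣ x₁) / W(y ∣ x₂) ≤ e ^ ρ` for all `x₁, x₂, y`, with the denominator cleared. -/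
def ldpChannels (k : ℕ) (𝒴 : Type*) (ρ : ℝ) : Set (Channel k 𝒴) :=
  {W | ∀ (y : 𝒴) (x₁ x₂ : Fin k), W x₁ y ≤ ENNReal.ofReal (Real.exp ρ) * W x₂ y}

/-- A private-coin simultaneous-message-passing protocol for `n` players, using channels from `𝒲`:
player `i` draws its own coin `U i ∼ coin i` and then uses the channel `channel i (U i) ∈ 𝒲`. -/
structure PrivateCoinProtocol (n k : ℕ) {𝒴 : Type*} (𝒲 : Set (Channel k 𝒴)) where
  Coin : Type
  coin : Fin n → PMF Coin
  channel : Fin n → Coin → Channel k 𝒴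
  channel_mem : ∀ i u, channel i u ∈ 𝒲

/-- The law of the messages `(Y 0, …, Y (n-1))` when the samples are i.i.d. from `p`: the coins are
independent of each other and of the samples, and, given samples and coins, the messages are
independent with `Y i` the output of the channel of player `i` on input `X i`. -/
noncomputable def PrivateCoinProtocol.messages {n k : ℕ} {𝒴 : Type*} {𝒲 : Set (Channel k 𝒴)}
    (P : PrivateCoinProtocol n k 𝒲) (p : PMF (Fin k)) : PMF (Fin n → 𝒴) :=
  (PMF.independent fun _ : Fin n => p).bind fun X =>
    (PMF.independent P.coin).bind fun U =>
      PMF.independent fun i => P.channel i (U i) (X i)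

/-- The randomized decision `T` of the referee, who sees the messages only (and not the coins),
is an `(n, ε)`-test of uniformity. `true` stands for accepting, that is for the output `1`. -/
def PrivateCoinProtocol.IsUniformityTest {n k : ℕ} [NeZero k] {𝒴 : Type*} {𝒲 : Set (Channel k 𝒴)}
    (P : PrivateCoinProtocol n k 𝒲) (T : (Fin n → 𝒴) → PMF Bool) (ε : ℝ) : Prop :=
  (11 / 12 < ((P.messages (PMF.uniformOfFintype (Fin k))).bind T) true) ∧
  ∀ p : PMF (Fin k), ε < tvDist p (PMF.uniformOfFintype (Fin k)) →
    11 / 12 < ((P.messages p).bind T) false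

/-- The sample complexity of `(k, ε)`-uniformity testing using `𝒲` for private-coin protocols: the
least `n` for which an `(n, ε)`-test exists (and `⊤` if there is none). -/
noncomputable def privateCoinSampleComplexity {k : ℕ} [NeZero k] {𝒴 : Type*}
    (𝒲 : Set (Channel k 𝒴)) (ε : ℝ) : ℕ∞ :=
  sInf {N : ℕ∞ | ∃ n : ℕ, N = n ∧ ∃ (P : PrivateCoinProtocol n k 𝒲) (T : (Fin n → 𝒴) → PMF Bool),
    P.IsUniformityTest T ε}

/-! Private coins can be averaged out: the messages are independent, with channels that are again
locally private. Write an alternative as `(1 + v) / k` with `v` of mean zero. The chi-square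
correlation of the message laws for `v` and `v'` is at most `exp (v ⬝ᵥ M.mulVec v' / k ^ 2)`, where
`M` is the sum of the information matrices of the averaged channels. Privacy bounds the entries of
`M` by `4 * n * ρ ^ 2`, hence its trace by `4 * k * n * ρ ^ 2`. A prior on `v` whose average
correlation is at most `2` and which is mostly far from uniform excludes a test
(`not_isUniformityTest`).

Since the protocol is fixed before the prior is chosen, `v` may depend on `M` (`exists_prior`). It
is kept orthogonal to the few eigenvectors of `M` with eigenvalue above `τ`, of order `n * ρ ^ 2`.
Then `M.mulVec v'` has norm at most `τ * ‖v'‖`, and if `v` is subgaussian the average correlation is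
bounded as soon as `ε ^ 4 * τ ^ 2 / k ^ 3` is small. This is the claimed rate.

Sign perturbations with entries `±a`, `a ≤ 1`, reach distance at most `1 / 2`, but `ε` may be close
to `1`. So `v` comes from a random walk in the box `[-1, B] ^ k` that freezes coordinates near the
ends (`exists_walk`). Its energy grows while many coordinates are free and is bounded by the box, so
usually nearly all coordinates end up frozen; mean zero then forces an `ℓ¹` norm close to `2 * k`.
Bounded `k` is handled by a single alternative (`not_isUniformityTest_of_mul_le`). -/

/-! ### Averages over random signs -/

/-- The sign `1` or `-1` encoded by a boolean. -/
def Bool.sign (b : Bool) : ℝ := if b then 1 else -1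

theorem Bool.sign_not (b : Bool) : (!b).sign = -b.sign := by cases b <;> simp [Bool.sign]

theorem Bool.sign_mul_self (b : Bool) : b.sign * b.sign = 1 := by cases b <;> simp [Bool.sign]

/-- The average factors over coordinates, and each factor is `cosh (a i) ≤ exp (a i ^ 2 / 2)`. -/
theorem sum_exp_sum_sign_mul_le {ι : Type*} [Fintype ι] [DecidableEq ι] (a : ι → ℝ) :
    ∑ s : ι → Bool, Real.exp (∑ i, (s i).sign * a i) ≤
      Fintype.card (ι → Bool) * Real.exp ((∑ i, a i ^ 2) / 2) := by
  have h1 : ∑ s : ι → Bool, Real.exp (∑ i, (s i).sign * a i) =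
      ∏ i, ∑ b : Bool, Real.exp (b.sign * a i) := by
    rw [Finset.prod_univ_sum, Fintype.piFinset_univ]
    exact Finset.sum_congr rfl fun s _ => Real.exp_sum _ _
  have h2 : ∀ i, ∑ b : Bool, Real.exp (b.sign * a i) ≤ 2 * Real.exp (a i ^ 2 / 2) := by
    intro i
    have := Real.cosh_le_exp_half_sq (a i)
    rw [Real.cosh_eq] at this
    simp only [Fintype.sum_bool, Bool.sign]
    norm_num
    linarith
  rw [h1]
  refine (Finset.prod_le_prod (fun i _ => Finset.sum_nonneg fun b _ => (Real.exp_pos _).le)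
    fun i _ => h2 i).trans_eq ?_
  rw [Finset.prod_mul_distrib, ← Real.exp_sum, Finset.sum_div]
  simp

theorem sum_sum_sign_mul_eq_zero {ι : Type*} [Fintype ι] [DecidableEq ι] (a : ι → ℝ) :
    ∑ s : ι → Bool, ∑ i, (s i).sign * a i = 0 := by
  have h : ∑ s : ι → Bool, ∑ i, (s i).sign * a i = ∑ s : ι → Bool, ∑ i, (!(s i)).sign * a i := by
    refine (Equiv.sum_comp (Equiv.piCongrRight fun _ : ι => Equiv.boolNot)
      fun s => ∑ i, (s i).sign * a i).symm
  simp only [Bool.sign_not, neg_mul, Finset.sum_neg_distrib] at h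
  linarith

/-! ### A subgaussian random walk in a slice of a box -/

section Walk

variable {ι J : Type*} [Fintype ι] [Fintype J]

/-- The coordinates of `v` that are at distance more than `r` from the ends of `[-1, B]`. -/
noncomputable def freeCoords (B r : ℝ) (v : EuclideanSpace ℝ ι) : Finset ι :=
  open Classical in Finset.univ.filter fun x => -1 + r < v x ∧ v x < B - r

/-- The vectors in the kernel of `f` with coordinates in `[-1, B]`. -/
def kerBox (f : EuclideanSpace ℝ ι →ₗ[ℝ] (J → ℝ)) (B : ℝ) : Set (EuclideanSpace ℝ ι) :=
  {v | f v = 0 ∧ ∀ x, -1 ≤ v x ∧ v x ≤ B}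

/-- If few enough coordinates are frozen, the kernel of `f` contains `d` orthonormal vectors that
vanish on the frozen coordinates. -/
theorem exists_orthonormal_of_card (f : EuclideanSpace ℝ ι →ₗ[ℝ] (J → ℝ)) (S : Finset ι) (d : ℕ)
    (h : Fintype.card J + d ≤ S.card) :
    ∃ w : Fin d → EuclideanSpace ℝ ι, Orthonormal ℝ w ∧ ∀ j, f (w j) = 0 ∧ ∀ x ∉ S, w j x = 0 := by
  classical
  -- Vanishing on the frozen coordinates is a further set of linear constraints; rank-nullity leaves
  -- a kernel of dimension at least `d`.
  let F : EuclideanSpace ℝ ι →ₗ[ℝ] (J → ℝ) × ((Sᶜ : Finset ι) → ℝ) :=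
    f.prod (LinearMap.pi fun x => (EuclideanSpace.projₗ x.1))
  have h1 := F.finrank_range_add_finrank_ker
  have h2 : Module.finrank ℝ (LinearMap.range F) ≤ Fintype.card J + (Sᶜ : Finset ι).card := by
    refine (Submodule.finrank_le _).trans ?_
    rw [Module.finrank_prod, Module.finrank_fintype_fun_eq_card, Module.finrank_fintype_fun_eq_card,
      Fintype.card_coe]
  rw [finrank_euclideanSpace] at h1
  have h3 := Finset.card_add_card_compl S
  have h4 : d ≤ Module.finrank ℝ (LinearMap.ker F) := by omega
  let b := stdOrthonormalBasis ℝ (LinearMap.ker F)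
  refine ⟨fun j => (b (Fin.castLE h4 j) : EuclideanSpace ℝ ι), ?_, fun j => ?_⟩
  · exact (b.orthonormal.comp _ (Fin.castLE_injective h4)).comp_linearIsometry
      (LinearMap.ker F).subtypeₗᵢ
  · have hm : F (b (Fin.castLE h4 j) : EuclideanSpace ℝ ι) = 0 := (b (Fin.castLE h4 j)).2
    rw [Prod.ext_iff] at hm
    refine ⟨hm.1, fun x hx => ?_⟩
    exact congrFun hm.2 ⟨x, Finset.mem_compl.2 hx⟩

theorem norm_sum_sign_smul_sq {E : Type*} [NormedAddCommGroup E] [InnerProductSpace ℝ E] {d : ℕ}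
    {w : Fin d → E} (hw : Orthonormal ℝ w) (s : Fin d → Bool) :
    ‖∑ j, (s j).sign • w j‖ ^ 2 = d := by
  rw [← real_inner_self_eq_norm_sq, hw.inner_sum]
  simp [Bool.sign_mul_self]

/-- One step of the walk. -/
theorem exists_walk_step (f : EuclideanSpace ℝ ι →ₗ[ℝ] (J → ℝ)) {B r δ : ℝ} {d N : ℕ}
    (hN : Fintype.card J + d ≤ N) (hδ : 0 ≤ δ) (hr : δ * √d ≤ r)
    {v : EuclideanSpace ℝ ι} (hv : v ∈ kerBox f B) :
    ∃ s : (Fin d → Bool) → EuclideanSpace ℝ ι,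
      (∀ σ, v + s σ ∈ kerBox f B) ∧
      (∀ θ, ∑ σ, Real.exp (inner ℝ θ (s σ)) ≤
        Fintype.card (Fin d → Bool) * Real.exp (δ ^ 2 * ‖θ‖ ^ 2 / 2)) ∧
      (N < (freeCoords B r v).card →
        ∑ σ, ‖v + s σ‖ ^ 2 = Fintype.card (Fin d → Bool) * (‖v‖ ^ 2 + δ ^ 2 * d)) ∧
      ((freeCoords B r v).card ≤ N → ∀ σ, s σ = 0) := by
  classical
  -- With at most `N` free coordinates the walk halts.
  by_cases hc : (freeCoords B r v).card ≤ N
  · refine ⟨fun _ => 0, by simpa using hv, fun θ => ?_, fun h => absurd hc (not_le.2 h), by simp⟩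
    simp only [inner_zero_right, Real.exp_zero, Finset.sum_const, Finset.card_univ, nsmul_eq_mul]
    gcongr
    exact Real.one_le_exp (by positivity)
  · push Not at hc
    obtain ⟨w, hw, hw'⟩ := exists_orthonormal_of_card f (freeCoords B r v) d (hN.trans hc.le)
    have hinner : ∀ θ (σ : Fin d → Bool), inner ℝ θ (δ • ∑ j, (σ j).sign • w j) =
        ∑ j, (σ j).sign * (δ * inner ℝ θ (w j)) := by
      intro θ σ
      rw [inner_smul_right, inner_sum, Finset.mul_sum]
      refine Finset.sum_congr rfl fun j _ => ?_
      rw [inner_smul_right]; ring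
    refine ⟨fun σ => δ • ∑ j, (σ j).sign • w j, fun σ => ⟨?_, fun x => ?_⟩, fun θ => ?_,
      fun _ => ?_, fun h => absurd hc (not_lt.2 h)⟩
    · simp [hv.1, fun j => (hw' j).1]
    · have hx := hv.2 x
      by_cases hxS : x ∈ freeCoords B r v
      · have h1 : |(δ • ∑ j, (σ j).sign • w j) x| ≤ r := by
          refine le_trans ?_ hr
          rw [PiLp.smul_apply, smul_eq_mul, abs_mul, abs_of_nonneg hδ]
          refine mul_le_mul_of_nonneg_left ?_ hδ
          rw [← norm_sum_sign_smul_sq hw σ, Real.sqrt_sq (norm_nonneg _)]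
          exact PiLp.norm_apply_le (∑ j, (σ j).sign • w j) x
        simp only [freeCoords, Finset.mem_filter] at hxS
        rw [abs_le] at h1
        rw [PiLp.add_apply]
        constructor <;> linarith
      · have h1 : (δ • ∑ j, (σ j).sign • w j) x = 0 := by
          simp [WithLp.ofLp_sum, Finset.sum_apply, fun j => (hw' j).2 x hxS]
        rw [PiLp.add_apply, h1, add_zero]
        exact hx
    · simp only [hinner]
      refine (sum_exp_sum_sign_mul_le _).trans ?_
      gcongr
      simp only [mul_pow, ← Finset.mul_sum]
      gcongr
      -- Bessel's inequality makes the subgaussian constant of a step independent of `d`, while the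
      -- energy gained is proportional to `d`.
      have := hw.sum_inner_products_le (s := Finset.univ) (x := θ)
      simpa only [Real.norm_eq_abs, sq_abs, real_inner_comm] using this
    · have h1 : ∀ σ : Fin d → Bool, ‖v + δ • ∑ j, (σ j).sign • w j‖ ^ 2 =
          (‖v‖ ^ 2 + δ ^ 2 * d) + 2 * ∑ j, (σ j).sign * (δ * inner ℝ v (w j)) := by
        intro σ
        rw [norm_add_sq_real, hinner, norm_smul, mul_pow, norm_sum_sign_smul_sq hw, Real.norm_eq_abs,
          sq_abs]
        ring
      simp only [h1]
      rw [Finset.sum_add_distrib, ← Finset.mul_sum, sum_sum_sign_mul_eq_zero, Finset.sum_const,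
        Finset.card_univ, nsmul_eq_mul, mul_zero, add_zero]

/-- A random walk in the kernel of `f` inside the box `[-1, B] ^ ι`: after `m` steps it is
subgaussian, and it is unlikely to have more than `N` free coordinates. -/
theorem exists_walk (f : EuclideanSpace ℝ ι →ₗ[ℝ] (J → ℝ)) {B r δ : ℝ} {d N : ℕ} (hB : 0 ≤ B)
    (hN : Fintype.card J + d ≤ N) (hδ : 0 ≤ δ) (hr : δ * √d ≤ r) (m : ℕ) :
    ∃ (Ω : Type) (_ : Fintype Ω) (_ : Nonempty Ω) (v : Ω → EuclideanSpace ℝ ι),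
      (∀ ω, v ω ∈ kerBox f B) ∧
      (∀ θ, ∑ ω, Real.exp (inner ℝ θ (v ω)) ≤
        Fintype.card Ω * Real.exp (m * δ ^ 2 * ‖θ‖ ^ 2 / 2)) ∧
      m * δ ^ 2 * d * ((Finset.univ.filter fun ω => N < (freeCoords B r (v ω)).card).card : ℝ) ≤
        ∑ ω, ‖v ω‖ ^ 2 := by
  classical
  induction m with
  | zero =>
    refine ⟨Unit, inferInstance, inferInstance, fun _ => 0, fun _ => ⟨by simp, fun x => ?_⟩, ?_, ?_⟩
    · simp [hB]
    · simp
    · simp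
  | succ m ih =>
    obtain ⟨Ω, _, _, v, hv, hexp, hen⟩ := ih
    choose s hs1 hs2 hs3 hs4 using fun ω => exists_walk_step f hN hδ hr (hv ω)
    refine ⟨Ω × (Fin d → Bool), inferInstance, inferInstance, fun p => v p.1 + s p.1 p.2,
      fun p => hs1 _ _, fun θ => ?_, ?_⟩
    · rw [Fintype.sum_prod_type]
      simp only [inner_add_right, Real.exp_add, ← Finset.mul_sum]
      calc _ ≤ ∑ ω, Real.exp (inner ℝ θ (v ω)) *
            (Fintype.card (Fin d → Bool) * Real.exp (δ ^ 2 * ‖θ‖ ^ 2 / 2)) := by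
            gcongr with ω
            exact hs2 ω θ
        _ ≤ Fintype.card Ω * Real.exp (m * δ ^ 2 * ‖θ‖ ^ 2 / 2) *
            (Fintype.card (Fin d → Bool) * Real.exp (δ ^ 2 * ‖θ‖ ^ 2 / 2)) := by
            rw [← Finset.sum_mul]
            gcongr
            exact hexp θ
        _ = _ := by
            rw [Fintype.card_prod, mul_mul_mul_comm, ← Real.exp_add]
            push_cast
            congr 2
            ring
    · obtain ⟨C, hC⟩ : ∃ C : ℝ, (Fintype.card (Fin d → Bool) : ℝ) = C := ⟨_, rfl⟩
      have hC0 : 0 ≤ C := hC ▸ Nat.cast_nonneg _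
      simp only [hC] at hs2 hs3
      set A := Finset.univ.filter fun ω => N < (freeCoords B r (v ω)).card
      have h1 : ∀ ω, ∑ σ, ‖v ω + s ω σ‖ ^ 2 =
          C * (‖v ω‖ ^ 2 + if ω ∈ A then δ ^ 2 * d else 0) := by
        intro ω
        by_cases hω : N < (freeCoords B r (v ω)).card
        · rw [hs3 ω hω, if_pos (by simpa [A] using hω)]
        · rw [if_neg (by simpa [A] using hω)]
          simp [hs4 ω (not_lt.1 hω), ← hC]
      -- A halted walk stays halted, so a walk still running after this step was running before it.
      have h2 : ((Finset.univ.filter fun p : Ω × (Fin d → Bool) =>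
          N < (freeCoords B r (v p.1 + s p.1 p.2)).card).card : ℝ) ≤ A.card * C := by
        have : (Finset.univ.filter fun p : Ω × (Fin d → Bool) =>
            N < (freeCoords B r (v p.1 + s p.1 p.2)).card) ⊆ A ×ˢ Finset.univ := by
          intro p hp
          simp only [Finset.mem_filter, Finset.mem_univ, true_and, Finset.mem_product, A,
            and_true] at hp ⊢
          by_contra h
          rw [hs4 p.1 (not_lt.1 h), add_zero] at hp
          exact h hp
        have := Finset.card_le_card this
        rw [Finset.card_product, Finset.card_univ] at this
        rw [← hC]
        exact_mod_cast this
      rw [Fintype.sum_prod_type]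
      simp only [h1, ← Finset.mul_sum, Finset.sum_add_distrib, Finset.sum_ite_mem, Finset.univ_inter,
        Finset.sum_const, nsmul_eq_mul]
      calc _ ≤ ((m + 1 : ℕ) : ℝ) * δ ^ 2 * d * (A.card * C) :=
            mul_le_mul_of_nonneg_left h2 (by positivity)
        _ = C * (m * δ ^ 2 * d * A.card + A.card * (δ ^ 2 * d)) := by push_cast; ring
        _ ≤ _ := mul_le_mul_of_nonneg_left (by linarith) hC0

end Walk

/-! ### The prior adapted to a positive semidefinite matrix -/

section Prior

variable {ι : Type*} [Fintype ι]

-- Markov's inequality for the eigenvalues, which are nonnegative and sum to the trace.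
open Classical in
theorem Matrix.PosSemidef.card_eigenvalues_mul_le_trace {M : Matrix ι ι ℝ} (hM : M.PosSemidef)
    (τ : ℝ) : (Fintype.card {j // τ < hM.1.eigenvalues j} : ℝ) * τ ≤ M.trace := by
  have h : M.trace = ∑ j, hM.1.eigenvalues j := by
    simpa using hM.1.trace_eq_sum_eigenvalues
  rw [h, Fintype.card_subtype, ← nsmul_eq_mul, ← Finset.sum_const]
  refine (Finset.sum_le_sum fun j hj => ?_).trans
    (Finset.sum_le_sum_of_subset_of_nonneg (Finset.filter_subset _ _)
      fun j _ _ => hM.eigenvalues_nonneg j)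
  exact (Finset.mem_filter.1 hj).2.le

-- In the eigenbasis, only components with eigenvalue at most `τ` survive.
open Classical in
theorem Matrix.PosSemidef.norm_mulVec_sq_le {M : Matrix ι ι ℝ} (hM : M.PosSemidef) {τ : ℝ}
    (v : EuclideanSpace ℝ ι)
    (hv : ∀ j, τ < hM.1.eigenvalues j → inner ℝ (hM.1.eigenvectorBasis j) v = 0) :
    ‖WithLp.toLp 2 (M.mulVec v)‖ ^ 2 ≤ τ ^ 2 * ‖v‖ ^ 2 := by
  have h1 : ∀ j, inner ℝ (hM.1.eigenvectorBasis j) (WithLp.toLp 2 (M.mulVec v)) =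
      hM.1.eigenvalues j * inner ℝ (hM.1.eigenvectorBasis j) v := by
    intro j
    have h2 : inner ℝ (hM.1.eigenvectorBasis j) (WithLp.toLp 2 (M.mulVec v)) =
        (M.mulVec v) ⬝ᵥ (hM.1.eigenvectorBasis j : ι → ℝ) := by
      rw [EuclideanSpace.inner_eq_star_dotProduct]; simp
    have h3 : M.vecMul (hM.1.eigenvectorBasis j) = M.mulVec (hM.1.eigenvectorBasis j) := by
      rw [← Matrix.mulVec_transpose]
      congr 1
      simpa using hM.1.eq
    rw [h2, dotProduct_comm, Matrix.dotProduct_mulVec, h3, hM.1.mulVec_eigenvectorBasis,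
      smul_dotProduct, smul_eq_mul, EuclideanSpace.inner_eq_star_dotProduct, dotProduct_comm]
    simp
  rw [← hM.1.eigenvectorBasis.sum_sq_norm_inner_right,
    ← hM.1.eigenvectorBasis.sum_sq_norm_inner_right v, Finset.mul_sum]
  refine Finset.sum_le_sum fun j _ => ?_
  rw [h1, norm_mul, mul_pow]
  by_cases hj : τ < hM.1.eigenvalues j
  · simp [hv j hj]
  · refine mul_le_mul_of_nonneg_right ?_ (by positivity)
    have := hM.eigenvalues_nonneg j
    rw [Real.norm_of_nonneg this]
    exact pow_le_pow_left₀ this (not_lt.1 hj) 2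

/-- A vector with mean zero, most of whose coordinates are close to `-1` or `B` or outside
`[-1, B]`, has large `ℓ¹` norm. -/
theorem lt_sum_abs_of_card_freeCoords_le {g B r : ℝ} {v : EuclideanSpace ℝ ι} (hg : 0 < g)
    (hg1 : g ≤ 1 / 2) (hr : r = g / 4) (hB : B = 4 / g + g / 4) (hι : 0 < Fintype.card ι)
    (hv0 : ∑ x, v x = 0)
    (hfree : ((freeCoords B r v).card : ℝ) ≤ g / 4 * Fintype.card ι) :
    2 * (1 - g) * Fintype.card ι < ∑ x, |v x| := by
  classical
  -- The term linear in `v x` sums to zero. Below `-1 + r` the right side is `2 * |v x|`; above `B -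
  -- r = 4 / g` it is `g / 2 * v x ≥ 2`.
  have hpt : ∀ x, 2 * (1 - r) * (if x ∈ freeCoords B r v then 0 else 1) ≤
      |v x| * (1 + g / 4) - v x * (1 - g / 4) := by
    intro x
    have habs := abs_nonneg (v x)
    have hle := le_abs_self (v x)
    have hle' := neg_le_abs (v x)
    by_cases hx : x ∈ freeCoords B r v
    · rw [if_pos hx]; nlinarith
    · rw [if_neg hx]
      simp only [freeCoords, Finset.mem_filter, Finset.mem_univ, true_and, not_and, not_lt] at hx
      by_cases h1 : -1 + r < v x
      · have h2 := hx h1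
        have h3 : g / 4 * (4 / g) = 1 := by field_simp
        have h4 : 4 / g ≤ v x := by rw [hB, hr] at h2; linarith
        nlinarith
      · nlinarith
  have hsum := Finset.sum_le_sum fun x (_ : x ∈ Finset.univ) => hpt x
  have hcard : ∑ x : ι, (if x ∈ freeCoords B r v then (0 : ℝ) else 1) =
      Fintype.card ι - (freeCoords B r v).card := by
    have : ∀ x : ι, (if x ∈ freeCoords B r v then (0 : ℝ) else 1) =
        1 - if x ∈ freeCoords B r v then (1 : ℝ) else 0 := fun x => by split_ifs <;> norm_num
    simp only [this, Finset.sum_sub_distrib]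
    simp
  rw [← Finset.mul_sum, hcard, Finset.sum_sub_distrib, ← Finset.sum_mul, ← Finset.sum_mul, hv0,
    hr] at hsum
  rw [hr] at hfree
  have hk : (0 : ℝ) < Fintype.card ι := by exact_mod_cast hι
  set K : ℝ := (Fintype.card ι : ℝ)
  have h5 : 2 * (1 - g / 4) * ((1 - g / 4) * K) ≤ (∑ x, |v x|) * (1 + g / 4) := by
    refine le_trans ?_ (hsum.trans (by linarith))
    refine mul_le_mul_of_nonneg_left ?_ (by linarith)
    linarith
  have h6 : 2 * (1 - g) * K * (1 + g / 4) < (∑ x, |v x|) * (1 + g / 4) := by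
    refine lt_of_lt_of_le ?_ h5
    nlinarith [mul_pos hk hg, mul_pos (mul_pos hk hg) hg]
  exact lt_of_mul_lt_mul_right h6 (by linarith)

/-- For a positive semidefinite `M` there is a random mean-zero vector, usually of large `ℓ¹` norm,
for which the exponential moments of the decoupled chaos of `M` are controlled by the trace. -/
theorem exists_prior {g τ : ℝ} (hg : 0 < g) (hg1 : g ≤ 1 / 2) (hτ : 0 < τ) {M : Matrix ι ι ℝ}
    (hM : M.PosSemidef) (hk : 16 / g ≤ Fintype.card ι)
    (htr : M.trace ≤ g / 16 * Fintype.card ι * τ) {B T : ℝ} (hB : B = 4 / g + g / 4)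
    (hT : T = 12 * B ^ 2 / (g / 16)) :
    ∃ (Ω : Type) (_ : Fintype Ω) (_ : Nonempty Ω) (v : Ω → ι → ℝ),
      (∀ ω x, -1 ≤ v ω x) ∧ (∀ ω, ∑ x, v ω x = 0) ∧
      12 * (Nat.card {ω // ¬ 2 * (1 - g) * Fintype.card ι < ∑ x, |v ω x|}) ≤ Fintype.card Ω ∧
      ∀ s, ∑ ω, ∑ ω', Real.exp (s * (v ω ⬝ᵥ M.mulVec (v ω'))) ≤
        Fintype.card Ω ^ 2 *
          Real.exp (T * (s ^ 2 * (τ ^ 2 * (B ^ 2 * Fintype.card ι))) / 2) := by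
  classical
  set K : ℝ := (Fintype.card ι : ℝ) with hK
  have hK0 : 0 < K := lt_of_lt_of_le (by positivity) hk
  have hι : 0 < Fintype.card ι := Nat.cast_pos.1 hK0
  have hgK : 16 ≤ g * K := by rwa [div_le_iff₀' hg] at hk
  have hB1 : 1 ≤ B := by
    have : 1 ≤ 4 / g := by rw [le_div_iff₀ hg]; linarith
    linarith
  have hT0 : 0 < T := by rw [hT]; positivity
  let J := {j // τ < hM.1.eigenvalues j}
  -- The constraints: orthogonality to the large eigenvectors, and mean zero.
  let f : EuclideanSpace ℝ ι →ₗ[ℝ] (J ⊕ Unit → ℝ) := LinearMap.pi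
    (Sum.elim (fun j => (innerₛₗ ℝ) (hM.1.eigenvectorBasis j.1))
      fun _ => ∑ x, EuclideanSpace.projₗ x)
  have hJ : (Fintype.card (J ⊕ Unit) : ℝ) ≤ g / 16 * K + 1 := by
    have := (hM.card_eigenvalues_mul_le_trace τ).trans htr
    rw [Fintype.card_sum, Fintype.card_unit]
    push_cast
    have := le_of_mul_le_mul_right this hτ
    linarith
  set d := ⌈g / 16 * K⌉₊ with hd
  have hd1 : g / 16 * K ≤ d := Nat.le_ceil _
  have hd2 : (d : ℝ) < g / 16 * K + 1 := Nat.ceil_lt_add_one (by positivity)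
  -- The total variance `m * δ ^ 2 = T` is fixed; `m` is taken large so that a single step has
  -- length at most `g / 4`.
  obtain ⟨m, hm⟩ := exists_nat_ge (T * d / (g / 4) ^ 2 + 1)
  have hm0 : (0 : ℝ) < m := lt_of_lt_of_le (by positivity) hm
  have hmδ : m * √(T / m) ^ 2 = T := by
    rw [Real.sq_sqrt (by positivity)]; field_simp
  obtain ⟨Ω, i1, i2, v, hv, hexp, hen⟩ := exists_walk f (B := B) (r := g / 4) (δ := √(T / m))
    (d := d) (N := Fintype.card (J ⊕ Unit) + d) (by linarith) le_rfl (Real.sqrt_nonneg _) (by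
      rw [← Real.sqrt_mul (by positivity)]
      refine Real.sqrt_le_iff.2 ⟨by positivity, ?_⟩
      rw [div_mul_eq_mul_div, div_le_iff₀ hm0, ← div_le_iff₀' (by positivity)]
      linarith) m
  rw [hmδ] at hen hexp
  have hf : ∀ ω, (∀ j, τ < hM.1.eigenvalues j → inner ℝ (hM.1.eigenvectorBasis j) (v ω) = 0) ∧
      ∑ x, v ω x = 0 := by
    intro ω
    have h := (hv ω).1
    refine ⟨fun j hj => congrFun h (Sum.inl ⟨j, hj⟩), ?_⟩
    have := congrFun h (Sum.inr ())
    simpa [f] using this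
  have hnorm : ∀ ω, ‖v ω‖ ^ 2 ≤ B ^ 2 * K := by
    intro ω
    rw [EuclideanSpace.real_norm_sq_eq]
    calc _ ≤ ∑ _x : ι, B ^ 2 := Finset.sum_le_sum fun x _ => by
            have := (hv ω).2 x
            exact sq_le_sq' (by linarith) this.2
      _ = _ := by simp [hK, mul_comm]
  refine ⟨Ω, i1, i2, fun ω => v ω, fun ω x => ((hv ω).2 x).1, fun ω => (hf ω).2, ?_, fun s => ?_⟩
  · have h1 : Nat.card {ω // ¬ 2 * (1 - g) * K < ∑ x, |v ω x|} ≤ (Finset.univ.filter fun ω =>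
        Fintype.card (J ⊕ Unit) + d < (freeCoords B (g / 4) (v ω)).card).card := by
      rw [Nat.card_eq_fintype_card, Fintype.card_subtype]
      refine Finset.card_le_card fun ω hω => ?_
      simp only [Finset.mem_filter, Finset.mem_univ, true_and] at hω ⊢
      by_contra h
      refine hω (lt_sum_abs_of_card_freeCoords_le hg hg1 rfl hB hι
        (hf ω).2 ?_)
      have : ((freeCoords B (g / 4) (v ω)).card : ℝ) ≤ Fintype.card (J ⊕ Unit) + d := by
        exact_mod_cast not_lt.1 h
      linarith
    -- Walks still running carry energy at least `T * d` on average, while the box caps the energy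
    -- at `B ^ 2 * K`; `T` is chosen to make the ratio at most `1 / 12`.
    have h2 : T * d * (Nat.card {ω // ¬ 2 * (1 - g) * K < ∑ x, |v ω x|} : ℝ) ≤
        Fintype.card Ω * (B ^ 2 * K) := by
      calc _ ≤ _ := mul_le_mul_of_nonneg_left (Nat.cast_le.2 h1) (by positivity)
        _ ≤ _ := hen
        _ ≤ ∑ _ω : Ω, B ^ 2 * K := Finset.sum_le_sum fun ω _ => hnorm ω
        _ = _ := by simp
    have h3 : 12 * (B ^ 2 * K) ≤ T * d := by
      calc _ = T * (g / 16 * K) := by rw [hT]; field_simp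
        _ ≤ _ := by gcongr
    have h4 : (B ^ 2 * K) * (12 * (Nat.card {ω // ¬ 2 * (1 - g) * K < ∑ x, |v ω x|} : ℝ)) ≤
        (B ^ 2 * K) * Fintype.card Ω := by
      refine le_trans ?_ (h2.trans_eq (mul_comm _ _))
      rw [← mul_assoc, mul_comm (B ^ 2 * K)]
      gcongr
    exact_mod_cast le_of_mul_le_mul_left h4 (by positivity)
  · rw [Finset.sum_comm]
    have h1 : ∀ ω', ∑ ω, Real.exp (s * ((v ω : ι → ℝ) ⬝ᵥ M.mulVec (v ω'))) ≤
        Fintype.card Ω * Real.exp (T * (s ^ 2 * (τ ^ 2 * (B ^ 2 * K))) / 2) := by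
      intro ω'
      -- For fixed `ω'` the chaos is linear in `v ω`, so the subgaussian bound applies.
      have h2 := hexp (s • WithLp.toLp 2 (M.mulVec (v ω')))
      have h3 : ∀ ω, inner ℝ (s • WithLp.toLp 2 (M.mulVec (v ω'))) (v ω) =
          s * ((v ω : ι → ℝ) ⬝ᵥ M.mulVec (v ω')) := by
        intro ω
        rw [inner_smul_left, EuclideanSpace.inner_eq_star_dotProduct]
        simp
      simp only [h3] at h2
      refine h2.trans ?_
      rw [norm_smul, mul_pow, Real.norm_eq_abs, sq_abs]
      gcongr
      exact (hM.norm_mulVec_sq_le _ (hf ω').1).trans (by gcongr; exact hnorm ω')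
    refine (Finset.sum_le_sum fun ω' _ => h1 ω').trans_eq ?_
    simp only [Finset.sum_const, Finset.card_univ, nsmul_eq_mul]
    ring

end Prior

/-! ### Product laws and averaging over private coins -/

theorem ENNReal.tsum_pi_prod {α : Type*} {n : ℕ} (f : Fin n → α → ℝ≥0∞) :
    ∑' z : Fin n → α, ∏ i, f i (z i) = ∏ i, ∑' a, f i a := by
  induction n with
  | zero => simp [tsum_fintype]
  | succ n ih =>
    rw [← (Fin.consEquiv fun _ : Fin (n + 1) => α).tsum_eq, ENNReal.tsum_prod', Fin.prod_univ_succ,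
      ← ih, ← ENNReal.tsum_mul_right]
    refine tsum_congr fun a => ?_
    rw [← ENNReal.tsum_mul_left]
    refine tsum_congr fun z => ?_
    simp [Fin.consEquiv, Fin.prod_univ_succ]

namespace PrivateCoinProtocol

variable {n k : ℕ} {𝒴 : Type*} {𝒲 : Set (Channel k 𝒴)}

/-- The channel of player `i`, averaged over the private coin. -/
noncomputable def avgChannel (P : PrivateCoinProtocol n k 𝒲) (i : Fin n) : Channel k 𝒴 :=
  fun x => (P.coin i).bind fun u => P.channel i u x

/-- Independence of the coins across players is what lets the sum over coins factor; shared coins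
would give a mixture of products. -/
theorem messages_apply (P : PrivateCoinProtocol n k 𝒲) (p : PMF (Fin k)) (y : Fin n → 𝒴) :
    P.messages p y = ∏ i, ∑ x, p x * P.avgChannel i x (y i) := by
  simp only [messages, PMF.bind_apply, PMF.independent_apply]
  rw [Finset.prod_congr rfl fun i _ =>
      (tsum_fintype (L := .unconditional _) fun x => p x * P.avgChannel i x (y i)).symm,
    ← ENNReal.tsum_pi_prod fun i x => p x * P.avgChannel i x (y i)]
  refine tsum_congr fun X => ?_
  rw [Finset.prod_mul_distrib]
  simp only [avgChannel, PMF.bind_apply]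
  rw [← ENNReal.tsum_pi_prod fun i u => P.coin i u * P.channel i u (X i) (y i)]
  simp only [Finset.prod_mul_distrib]

/-- The privacy constraint is linear in the channel, so it survives averaging. -/
theorem avgChannel_mem_ldpChannels {ρ : ℝ} (P : PrivateCoinProtocol n k (ldpChannels k 𝒴 ρ))
    (i : Fin n) : P.avgChannel i ∈ ldpChannels k 𝒴 ρ := by
  intro y x₁ x₂
  simp only [avgChannel, PMF.bind_apply, ← ENNReal.tsum_mul_left]
  refine ENNReal.tsum_le_tsum fun u => ?_
  rw [mul_left_comm]
  gcongr
  exact P.channel_mem i u y x₁ x₂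

end PrivateCoinProtocol

theorem PMF.hasSum_toReal {α : Type*} (p : PMF α) : HasSum (fun a => (p a).toReal) 1 := by
  have := ENNReal.hasSum_toReal p.tsum_coe_ne_top
  rwa [← ENNReal.tsum_toReal_eq fun a => p.apply_ne_top a, p.tsum_coe, ENNReal.toReal_one] at this

/-! ### Chi-square geometry of a private channel -/

namespace Channel

variable {k : ℕ} {𝒴 : Type*}

/-- The probability of the output `y` for a uniformly distributed input. -/
noncomputable def outProb (W : Channel k 𝒴) (y : 𝒴) : ℝ := (∑ x, (W x y).toReal) / k

/-- The difference of `W(y ∣ x)` to its mean over `x`. -/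
noncomputable def dev (W : Channel k 𝒴) (x : Fin k) (y : 𝒴) : ℝ := (W x y).toReal - W.outProb y

/-- The matrix of the chi-square inner product of the outputs of `W`. -/
noncomputable def infoMatrix (W : Channel k 𝒴) : Matrix (Fin k) (Fin k) ℝ :=
  Matrix.of fun x x' => ∑' y, W.dev x y * W.dev x' y / W.outProb y

/-- The likelihood ratio of the outputs for input distributions `(1 + v) / k` and uniform. -/
noncomputable def likelihoodRatio (W : Channel k 𝒴) (v : Fin k → ℝ) (y : 𝒴) : ℝ :=
  ((∑ x, (1 + v x) * (W x y).toReal) / k) / W.outProb y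

theorem outProb_nonneg (W : Channel k 𝒴) (y : 𝒴) : 0 ≤ W.outProb y := by
  unfold outProb; positivity

theorem likelihoodRatio_nonneg (W : Channel k 𝒴) {v : Fin k → ℝ} (hv : ∀ x, -1 ≤ v x) (y : 𝒴) :
    0 ≤ W.likelihoodRatio v y := by
  refine div_nonneg (div_nonneg (Finset.sum_nonneg fun x _ => ?_) (by positivity))
    (W.outProb_nonneg y)
  exact mul_nonneg (by linarith [hv x]) ENNReal.toReal_nonneg

theorem sum_mul_toReal_div (W : Channel k 𝒴) {v : Fin k → ℝ} (hv : ∑ x, v x = 0) (y : 𝒴) :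
    (∑ x, (1 + v x) * (W x y).toReal) / k = W.outProb y + (∑ x, v x * W.dev x y) / k := by
  simp only [dev, mul_sub, Finset.sum_sub_distrib, ← Finset.sum_mul, hv, add_mul, one_mul,
    Finset.sum_add_distrib, add_div, zero_mul, sub_zero]
  rfl

variable [NeZero k]

theorem hasSum_outProb (W : Channel k 𝒴) : HasSum W.outProb 1 := by
  have h := (hasSum_sum fun x (_ : x ∈ Finset.univ) => (W x).hasSum_toReal).div_const (k : ℝ)
  have hk : (k : ℝ) ≠ 0 := Nat.cast_ne_zero.2 (NeZero.ne k)
  have h1 : (∑ _x : Fin k, (1 : ℝ)) / k = 1 := by simp [hk]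
  rw [h1] at h
  exact h

theorem sum_uniform_mul (W : Channel k 𝒴) (y : 𝒴) :
    ∑ x, PMF.uniformOfFintype (Fin k) x * W x y = ENNReal.ofReal (W.outProb y) := by
  have hk : (0 : ℝ) < k := Nat.cast_pos.2 (NeZero.pos k)
  rw [outProb, ENNReal.ofReal_div_of_pos hk, ENNReal.ofReal_natCast,
    ENNReal.ofReal_sum_of_nonneg fun x _ => ENNReal.toReal_nonneg, div_eq_mul_inv, Finset.sum_mul]
  refine Finset.sum_congr rfl fun x _ => ?_
  rw [ENNReal.ofReal_toReal ((W x).apply_ne_top y), PMF.uniformOfFintype_apply, Fintype.card_fin,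
    mul_comm]

theorem hasSum_dev (W : Channel k 𝒴) (x : Fin k) : HasSum (W.dev x) 0 := by
  have h := (W x).hasSum_toReal.sub W.hasSum_outProb
  rw [sub_self] at h
  exact h

/-- Where `W.outProb y = 0` every `W x y` vanishes, so the junk value of the quotient does no harm.
-/
theorem outProb_mul_likelihoodRatio (W : Channel k 𝒴) (v : Fin k → ℝ) (y : 𝒴) :
    W.outProb y * W.likelihoodRatio v y = (∑ x, (1 + v x) * (W x y).toReal) / k := by
  by_cases h : W.outProb y = 0
  · have hk : (k : ℝ) ≠ 0 := Nat.cast_ne_zero.2 (NeZero.ne k)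
    have h1 : ∀ x, (W x y).toReal = 0 := by
      have h2 : ∑ x, (W x y).toReal = 0 := by simpa [outProb, hk] using h
      rw [Finset.sum_eq_zero_iff_of_nonneg fun x _ => ENNReal.toReal_nonneg] at h2
      exact fun x => h2 x (Finset.mem_univ x)
    simp [h, h1]
  · rw [likelihoodRatio]
    field_simp

variable {ρ : ℝ} {W : Channel k 𝒴}

/-- Averaging the privacy constraint over one input puts `W x y / W.outProb y` between `exp (-ρ) ≥ 1
- ρ` and `exp ρ ≤ 1 + 2 * ρ`. -/
theorem abs_dev_le (hW : W ∈ ldpChannels k 𝒴 ρ) (hρ : 0 < ρ) (hρ1 : ρ ≤ 1) (x : Fin k) (y : 𝒴) :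
    |W.dev x y| ≤ 2 * ρ * W.outProb y := by
  have hk : (0 : ℝ) < k := Nat.cast_pos.2 (NeZero.pos k)
  have h : ∀ x₁ x₂, (W x₁ y).toReal ≤ Real.exp ρ * (W x₂ y).toReal := by
    intro x₁ x₂
    have := ENNReal.toReal_mono (ENNReal.mul_ne_top ENNReal.ofReal_ne_top ((W x₂).apply_ne_top y))
      (hW y x₁ x₂)
    rwa [ENNReal.toReal_mul, ENNReal.toReal_ofReal (Real.exp_pos ρ).le] at this
  have h1 : (W x y).toReal ≤ Real.exp ρ * W.outProb y := by
    rw [outProb, ← mul_div_assoc, le_div_iff₀ hk, Finset.mul_sum]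
    have := Finset.sum_le_sum fun x' (_ : x' ∈ Finset.univ) => h x x'
    simpa [mul_comm] using this
  have h2 : W.outProb y ≤ Real.exp ρ * (W x y).toReal := by
    rw [outProb, div_le_iff₀ hk]
    have := Finset.sum_le_sum fun x' (_ : x' ∈ Finset.univ) => h x' x
    simpa [mul_comm] using this
  have h3 := Real.abs_exp_sub_one_le (x := ρ) (by rw [abs_of_pos hρ]; exact hρ1)
  rw [abs_of_pos hρ] at h3
  have h4 := (abs_le.1 h3).2
  have h5 : (1 - ρ) * W.outProb y ≤ (W x y).toReal := by
    calc _ ≤ Real.exp (-ρ) * W.outProb y :=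
          mul_le_mul_of_nonneg_right (by linarith [Real.add_one_le_exp (-ρ)]) (W.outProb_nonneg y)
      _ ≤ Real.exp (-ρ) * (Real.exp ρ * (W x y).toReal) := by gcongr
      _ = _ := by rw [← mul_assoc, ← Real.exp_add]; simp
  have h6 := W.outProb_nonneg y
  rw [dev, abs_le]
  constructor <;> nlinarith

theorem abs_dev_mul_dev_div_le (hW : W ∈ ldpChannels k 𝒴 ρ) (hρ : 0 < ρ) (hρ1 : ρ ≤ 1)
    (x x' : Fin k) (y : 𝒴) :
    |W.dev x y * W.dev x' y / W.outProb y| ≤ 4 * ρ ^ 2 * W.outProb y := by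
  have h0 := W.outProb_nonneg y
  rw [abs_div, abs_mul, abs_of_nonneg h0]
  refine div_le_of_le_mul₀ h0 (by positivity) ?_
  calc _ ≤ (2 * ρ * W.outProb y) * (2 * ρ * W.outProb y) :=
        mul_le_mul (abs_dev_le hW hρ hρ1 x y) (abs_dev_le hW hρ hρ1 x' y) (abs_nonneg _)
          (by positivity)
    _ = _ := by ring

theorem hasSum_infoMatrix (hW : W ∈ ldpChannels k 𝒴 ρ) (hρ : 0 < ρ) (hρ1 : ρ ≤ 1)
    (x x' : Fin k) :
    HasSum (fun y => W.dev x y * W.dev x' y / W.outProb y) (W.infoMatrix x x') :=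
  (Summable.of_norm_bounded (W.hasSum_outProb.summable.mul_left (4 * ρ ^ 2))
    fun y => abs_dev_mul_dev_div_le hW hρ hρ1 x x' y).hasSum

theorem abs_infoMatrix_le (hW : W ∈ ldpChannels k 𝒴 ρ) (hρ : 0 < ρ) (hρ1 : ρ ≤ 1)
    (x x' : Fin k) : |W.infoMatrix x x'| ≤ 4 * ρ ^ 2 := by
  have h := W.hasSum_outProb.mul_left (4 * ρ ^ 2)
  rw [mul_one] at h
  exact tsum_of_norm_bounded (f := fun y => W.dev x y * W.dev x' y / W.outProb y) h
    fun y => abs_dev_mul_dev_div_le hW hρ hρ1 x x' y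

theorem hasSum_dotProduct_infoMatrix (hW : W ∈ ldpChannels k 𝒴 ρ) (hρ : 0 < ρ) (hρ1 : ρ ≤ 1)
    (v v' : Fin k → ℝ) :
    HasSum (fun y => (∑ x, v x * W.dev x y) * (∑ x, v' x * W.dev x y) / W.outProb y)
      (v ⬝ᵥ W.infoMatrix.mulVec v') := by
  have h := hasSum_sum fun x (_ : x ∈ Finset.univ) => (hasSum_sum fun x' (_ : x' ∈ Finset.univ) =>
    (hasSum_infoMatrix hW hρ hρ1 x x').mul_right (v' x')).mul_left (v x)
  refine HasSum.congr_fun h fun y => ?_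
  rw [Finset.sum_mul_sum, Finset.sum_div]
  refine Finset.sum_congr rfl fun x _ => ?_
  rw [Finset.mul_sum, Finset.sum_div]
  exact Finset.sum_congr rfl fun x' _ => by ring

theorem posSemidef_infoMatrix (hW : W ∈ ldpChannels k 𝒴 ρ) (hρ : 0 < ρ) (hρ1 : ρ ≤ 1) :
    W.infoMatrix.PosSemidef := by
  refine Matrix.PosSemidef.of_dotProduct_mulVec_nonneg ?_ fun v => ?_
  · ext x x'
    simp [infoMatrix, mul_comm]
  · rw [star_trivial]
    refine (hasSum_dotProduct_infoMatrix hW hρ hρ1 v v).nonneg fun y => ?_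
    exact div_nonneg (mul_self_nonneg _) (W.outProb_nonneg y)

/-- Each ratio is `1` plus a fluctuation of mean zero under `W.outProb`, so only the product of the
two fluctuations contributes beyond `1`. -/
theorem hasSum_outProb_mul_likelihoodRatio (hW : W ∈ ldpChannels k 𝒴 ρ) (hρ : 0 < ρ) (hρ1 : ρ ≤ 1)
    {v v' : Fin k → ℝ} (hv : ∑ x, v x = 0) (hv' : ∑ x, v' x = 0) :
    HasSum (fun y => W.outProb y * (W.likelihoodRatio v y * W.likelihoodRatio v' y))
      (1 + (v ⬝ᵥ W.infoMatrix.mulVec v') / k ^ 2) := by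
  have hdev : ∀ v : Fin k → ℝ, HasSum (fun y => (∑ x, v x * W.dev x y) / k) 0 := by
    intro v
    have := (hasSum_sum fun x (_ : x ∈ Finset.univ) => (W.hasSum_dev x).mul_left (v x)).div_const
      (k : ℝ)
    simpa using this
  have h := ((W.hasSum_outProb.add (hdev v)).add (hdev v')).add
    ((hasSum_dotProduct_infoMatrix hW hρ hρ1 v v').div_const ((k : ℝ) ^ 2))
  rw [add_zero, add_zero] at h
  refine HasSum.congr_fun h fun y => ?_
  by_cases hq : W.outProb y = 0
  · have hd : ∀ v : Fin k → ℝ, ∑ x, v x * W.dev x y = 0 := fun v =>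
      Finset.sum_eq_zero fun x _ => by
        have := abs_dev_le hW hρ hρ1 x y
        rw [hq, mul_zero, abs_nonpos_iff] at this
        rw [this, mul_zero]
    simp [hq, hd]
  · rw [likelihoodRatio, likelihoodRatio, sum_mul_toReal_div W hv, sum_mul_toReal_div W hv']
    have hk : (k : ℝ) ≠ 0 := Nat.cast_ne_zero.2 (NeZero.ne k)
    field_simp
    ring

end Channel

/-! ### The second-moment argument against a test -/

namespace PrivateCoinProtocol

variable {n k : ℕ} [NeZero k] {𝒴 : Type*} {ρ : ℝ}

/-- The sum of the information matrices of the averaged channels of all players. -/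
noncomputable def infoMatrix (P : PrivateCoinProtocol n k (ldpChannels k 𝒴 ρ)) :
    Matrix (Fin k) (Fin k) ℝ := ∑ i, (P.avgChannel i).infoMatrix

theorem posSemidef_infoMatrix (P : PrivateCoinProtocol n k (ldpChannels k 𝒴 ρ)) (hρ : 0 < ρ)
    (hρ1 : ρ ≤ 1) : P.infoMatrix.PosSemidef :=
  Matrix.posSemidef_sum _ fun i _ =>
    Channel.posSemidef_infoMatrix (P.avgChannel_mem_ldpChannels i) hρ hρ1

theorem abs_infoMatrix_le (P : PrivateCoinProtocol n k (ldpChannels k 𝒴 ρ)) (hρ : 0 < ρ)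
    (hρ1 : ρ ≤ 1) (x x' : Fin k) : |P.infoMatrix x x'| ≤ 4 * (n * ρ ^ 2) := by
  rw [infoMatrix, Matrix.sum_apply]
  refine (Finset.abs_sum_le_sum_abs _ _).trans ((Finset.sum_le_sum fun i _ =>
    Channel.abs_infoMatrix_le (P.avgChannel_mem_ldpChannels i) hρ hρ1 x x').trans_eq ?_)
  simp
  ring

theorem trace_infoMatrix_le (P : PrivateCoinProtocol n k (ldpChannels k 𝒴 ρ)) (hρ : 0 < ρ)
    (hρ1 : ρ ≤ 1) : P.infoMatrix.trace ≤ k * (4 * (n * ρ ^ 2)) := by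
  refine (Finset.sum_le_sum fun x _ => (le_abs_self _).trans
    (P.abs_infoMatrix_le hρ hρ1 x x)).trans_eq ?_
  simp

/-- The law of the messages has the product of the likelihood ratios as its density. -/
theorem messages_eq_mul (P : PrivateCoinProtocol n k (ldpChannels k 𝒴 ρ)) {p : PMF (Fin k)}
    {v : Fin k → ℝ} (hv : ∀ x, -1 ≤ v x) (hp : ∀ x, (p x).toReal = (1 + v x) / k)
    (y : Fin n → 𝒴) :
    P.messages p y = P.messages (PMF.uniformOfFintype (Fin k)) y *
      ENNReal.ofReal (∏ i, (P.avgChannel i).likelihoodRatio v (y i)) := by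
  rw [messages_apply, messages_apply, ENNReal.ofReal_prod_of_nonneg fun i _ =>
    (P.avgChannel i).likelihoodRatio_nonneg hv _, ← Finset.prod_mul_distrib]
  refine Finset.prod_congr rfl fun i _ => ?_
  rw [(P.avgChannel i).sum_uniform_mul, ← ENNReal.ofReal_mul (Channel.outProb_nonneg _ _),
    Channel.outProb_mul_likelihoodRatio, Finset.sum_div, ENNReal.ofReal_sum_of_nonneg]
  · refine Finset.sum_congr rfl fun x _ => ?_
    rw [mul_div_right_comm, ← hp, ← ENNReal.toReal_mul, ENNReal.ofReal_toReal]
    exact ENNReal.mul_ne_top (p.apply_ne_top x) ((P.avgChannel i x).apply_ne_top _)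
  · intro x _
    have := hv x
    exact div_nonneg (mul_nonneg (by linarith) ENNReal.toReal_nonneg) (Nat.cast_nonneg _)

/-- The chi-square correlation of two alternatives. -/
theorem tsum_messages_mul_le (P : PrivateCoinProtocol n k (ldpChannels k 𝒴 ρ)) (hρ : 0 < ρ)
    (hρ1 : ρ ≤ 1) {v v' : Fin k → ℝ} (hv : ∀ x, -1 ≤ v x) (hv' : ∀ x, -1 ≤ v' x)
    (hv0 : ∑ x, v x = 0) (hv0' : ∑ x, v' x = 0) :
    ∑' y, P.messages (PMF.uniformOfFintype (Fin k)) y *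
      ENNReal.ofReal ((∏ i, (P.avgChannel i).likelihoodRatio v (y i)) *
        ∏ i, (P.avgChannel i).likelihoodRatio v' (y i)) ≤
      ENNReal.ofReal (Real.exp (1 / k ^ 2 * (v ⬝ᵥ P.infoMatrix.mulVec v'))) := by
  let F : Fin n → 𝒴 → ℝ := fun i y => (P.avgChannel i).outProb y *
    ((P.avgChannel i).likelihoodRatio v y * (P.avgChannel i).likelihoodRatio v' y)
  have hF0 : ∀ i y, 0 ≤ F i y := fun i y => mul_nonneg (Channel.outProb_nonneg _ _)
    (mul_nonneg (Channel.likelihoodRatio_nonneg _ hv _) (Channel.likelihoodRatio_nonneg _ hv' _))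
  have hF : ∀ i, HasSum (F i) (1 + (v ⬝ᵥ (P.avgChannel i).infoMatrix.mulVec v') / k ^ 2) := fun i =>
    Channel.hasSum_outProb_mul_likelihoodRatio (P.avgChannel_mem_ldpChannels i) hρ hρ1 hv0 hv0'
  have h1 : ∀ y : Fin n → 𝒴, P.messages (PMF.uniformOfFintype (Fin k)) y *
      ENNReal.ofReal ((∏ i, (P.avgChannel i).likelihoodRatio v (y i)) *
        ∏ i, (P.avgChannel i).likelihoodRatio v' (y i)) = ∏ i, ENNReal.ofReal (F i (y i)) := by
    intro y
    rw [messages_apply, ← Finset.prod_mul_distrib, ENNReal.ofReal_prod_of_nonneg,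
      ← Finset.prod_mul_distrib]
    · refine Finset.prod_congr rfl fun i _ => ?_
      rw [(P.avgChannel i).sum_uniform_mul, ← ENNReal.ofReal_mul (Channel.outProb_nonneg _ _)]
    · exact fun i _ => mul_nonneg (Channel.likelihoodRatio_nonneg _ hv _)
        (Channel.likelihoodRatio_nonneg _ hv' _)
  simp only [h1]
  rw [ENNReal.tsum_pi_prod fun i y => ENNReal.ofReal (F i y), infoMatrix, Matrix.sum_mulVec,
    dotProduct_sum, Finset.mul_sum, Real.exp_sum,
    ENNReal.ofReal_prod_of_nonneg fun i _ => (Real.exp_pos _).le]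
  refine Finset.prod_le_prod' fun i _ => ?_
  rw [← ENNReal.ofReal_tsum_of_nonneg (hF0 i) (hF i).summable, (hF i).tsum_eq]
  refine ENNReal.ofReal_le_ofReal ?_
  rw [add_comm, one_div_mul_eq_div]
  exact Real.add_one_le_exp _

theorem bind_false_le_of_lt_bind_true {α : Type*} (q : PMF α) (T : α → PMF Bool)
    (h : 11 / 12 < (q.bind T) true) : (q.bind T) false ≤ ENNReal.ofReal (1 / 12) := by
  have h1 := (q.bind T).tsum_coe
  rw [tsum_fintype, Fintype.sum_bool] at h1
  have h2 : (11 / 12 : ℝ≥0∞) = ENNReal.ofReal (11 / 12) := by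
    rw [ENNReal.ofReal_div_of_pos (by norm_num)]; norm_num
  rw [h2] at h
  by_contra hc
  have h3 := ENNReal.add_lt_add h (not_le.1 hc)
  rw [h1, ← ENNReal.ofReal_add (by norm_num) (by norm_num)] at h3
  norm_num at h3

/-- If the decoupled exponential moment of a family of alternatives is at most `2` and most of them
are far from uniform, then there is no test. -/
theorem not_isUniformityTest {Ω : Type} [Fintype Ω] [Nonempty Ω]
    (P : PrivateCoinProtocol n k (ldpChannels k 𝒴 ρ)) (T : (Fin n → 𝒴) → PMF Bool) {ε : ℝ}
    (hρ : 0 < ρ) (hρ1 : ρ ≤ 1) (v : Ω → Fin k → ℝ) (hv : ∀ ω x, -1 ≤ v ω x)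
    (hv0 : ∀ ω, ∑ x, v ω x = 0)
    (hfar : 12 * Nat.card {ω // ¬ 2 * ε * k < ∑ x, |v ω x|} ≤ Fintype.card Ω)
    (hexp : ∑ ω, ∑ ω', Real.exp (1 / k ^ 2 * (v ω ⬝ᵥ P.infoMatrix.mulVec (v ω'))) ≤
      2 * Fintype.card Ω ^ 2) : ¬ P.IsUniformityTest T ε := by
  classical
  rintro ⟨h0, h1⟩
  have hk : (0 : ℝ) < k := Nat.cast_pos.2 (NeZero.pos k)
  have hsum1 : ∀ ω, ∑ x, ENNReal.ofReal ((1 + v ω x) / k) = 1 := by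
    intro ω
    rw [← ENNReal.ofReal_sum_of_nonneg fun x _ => div_nonneg (by linarith [hv ω x]) hk.le,
      ← Finset.sum_div, Finset.sum_add_distrib, hv0]
    simp [hk.ne']
  let p : Ω → PMF (Fin k) := fun ω => PMF.ofFintype _ (hsum1 ω)
  have hp : ∀ ω x, (p ω x).toReal = (1 + v ω x) / k := fun ω x =>
    ENNReal.toReal_ofReal (div_nonneg (by linarith [hv ω x]) hk.le)
  have htv : ∀ ω, tvDist (p ω) (PMF.uniformOfFintype (Fin k)) = (∑ x, |v ω x|) / (2 * k) := by
    intro ω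
    have : ∀ x, |(p ω x).toReal - (PMF.uniformOfFintype (Fin k) x).toReal| = |v ω x| / k := by
      intro x
      rw [hp, PMF.uniformOfFintype_apply, Fintype.card_fin, ENNReal.toReal_inv,
        ENNReal.toReal_natCast, add_div, one_div, add_sub_cancel_left, abs_div, abs_of_pos hk]
    simp only [tvDist, this, ← Finset.sum_div]
    ring
  set N : ℝ := (Fintype.card Ω : ℝ) with hN
  have hN0 : 0 < N := Nat.cast_pos.2 Fintype.card_pos
  set Q := P.messages (PMF.uniformOfFintype (Fin k)) with hQ
  let L : Ω → (Fin n → 𝒴) → ℝ := fun ω y => ∏ i, (P.avgChannel i).likelihoodRatio (v ω) (y i)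
  have hL0 : ∀ ω y, 0 ≤ L ω y := fun ω y =>
    Finset.prod_nonneg fun i _ => Channel.likelihoodRatio_nonneg _ (hv ω) _
  have hL : ∀ ω y, P.messages (p ω) y = Q y * ENNReal.ofReal (L ω y) := fun ω y =>
    P.messages_eq_mul (hv ω) (hp ω) y
  -- At least `11 / 12` of the alternatives are far, and each is rejected with probability above `11
  -- / 12`.
  have hlow : ENNReal.ofReal (121 / 144 * N) ≤ ∑ ω, ((P.messages (p ω)).bind T) false := by
    set A := Finset.univ.filter fun ω => 2 * ε * k < ∑ x, |v ω x| with hA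
    have hcard : 11 / 12 * N ≤ A.card := by
      have hc := Finset.card_filter_add_card_filter_not (s := (Finset.univ : Finset Ω))
        (fun ω => 2 * ε * k < ∑ x, |v ω x|)
      rw [Nat.card_eq_fintype_card, Fintype.card_subtype] at hfar
      rw [Finset.card_univ] at hc
      have h : 11 * Fintype.card Ω ≤ 12 * A.card := by rw [hA]; omega
      have h' : 11 * N ≤ 12 * A.card := by rw [hN]; exact_mod_cast h
      linarith
    calc ENNReal.ofReal (121 / 144 * N) ≤ ENNReal.ofReal (A.card * (11 / 12)) :=
          ENNReal.ofReal_le_ofReal (by linarith)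
      _ = ∑ ω ∈ A, ENNReal.ofReal (11 / 12) := by
          rw [Finset.sum_const, nsmul_eq_mul, ENNReal.ofReal_mul (Nat.cast_nonneg _),
            ENNReal.ofReal_natCast]
      _ ≤ ∑ ω ∈ A, ((P.messages (p ω)).bind T) false := by
          refine Finset.sum_le_sum fun ω hω => ?_
          have h2 : (11 / 12 : ℝ≥0∞) = ENNReal.ofReal (11 / 12) := by
            rw [ENNReal.ofReal_div_of_pos (by norm_num)]; norm_num
          rw [← h2]
          refine (h1 (p ω) ?_).le
          rw [htv, lt_div_iff₀ (by positivity)]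
          have := (Finset.mem_filter.1 hω).2
          linarith
      _ ≤ _ := Finset.sum_le_sum_of_subset (Finset.subset_univ _)
  -- With `S = ∑ ω, L ω y` and rejection probability `φ ≤ 1`, this is `S * φ ≤ S ^ 2 / (10 * N) + 5
  -- / 2 * N * φ`, by completing the square and `φ ^ 2 ≤ φ`.
  have hpt : ∀ y, ∑ ω, P.messages (p ω) y * T y false ≤
      (∑ ω, ∑ ω', Q y * ENNReal.ofReal (L ω y * L ω' y)) * ENNReal.ofReal (1 / (10 * N)) +
        Q y * T y false * ENNReal.ofReal (5 / 2 * N) := by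
    intro y
    have hT1 : (T y false).toReal ≤ 1 :=
      ENNReal.toReal_le_of_le_ofReal zero_le_one (by simpa using (T y).coe_le_one false)
    have hT0 : 0 ≤ (T y false).toReal := ENNReal.toReal_nonneg
    set φ := (T y false).toReal with hφ
    have hφ' : T y false = ENNReal.ofReal φ := (ENNReal.ofReal_toReal ((T y).apply_ne_top _)).symm
    have hS0 : 0 ≤ ∑ ω, L ω y := Finset.sum_nonneg fun ω _ => hL0 ω y
    have e1 : ∑ ω, P.messages (p ω) y * T y false = Q y * ENNReal.ofReal ((∑ ω, L ω y) * φ) := by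
      rw [ENNReal.ofReal_mul hS0, ENNReal.ofReal_sum_of_nonneg fun ω _ => hL0 ω y, ← hφ',
        ← mul_assoc, Finset.mul_sum, Finset.sum_mul]
      simp only [hL]
    have e2 : ∑ ω, ∑ ω', Q y * ENNReal.ofReal (L ω y * L ω' y) =
        Q y * ENNReal.ofReal ((∑ ω, L ω y) * ∑ ω, L ω y) := by
      rw [Finset.sum_mul_sum, ENNReal.ofReal_sum_of_nonneg fun ω _ => Finset.sum_nonneg fun ω' _ =>
        mul_nonneg (hL0 ω y) (hL0 ω' y), Finset.mul_sum]
      refine Finset.sum_congr rfl fun ω _ => ?_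
      rw [ENNReal.ofReal_sum_of_nonneg fun ω' _ => mul_nonneg (hL0 ω y) (hL0 ω' y), Finset.mul_sum]
    rw [e1, e2, hφ', mul_assoc, mul_assoc, ← mul_add, ← ENNReal.ofReal_mul (mul_self_nonneg _),
      ← ENNReal.ofReal_mul hT0, ← ENNReal.ofReal_add (by positivity) (by positivity)]
    gcongr
    set S := ∑ ω, L ω y
    have h3 : S * S * (1 / (10 * N)) + φ * (5 / 2 * N) - S * φ =
        (S - 5 * N * φ) ^ 2 / (10 * N) + 5 / 2 * N * (φ * (1 - φ)) := by
      field_simp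
      ring
    have h4 : 0 ≤ φ * (1 - φ) := mul_nonneg hT0 (by linarith)
    have h5 : 0 ≤ (S - 5 * N * φ) ^ 2 / (10 * N) + 5 / 2 * N * (φ * (1 - φ)) := by positivity
    linarith
  have hup : ∑ ω, ((P.messages (p ω)).bind T) false ≤
      ENNReal.ofReal (2 * N ^ 2) * ENNReal.ofReal (1 / (10 * N)) +
        ENNReal.ofReal (1 / 12) * ENNReal.ofReal (5 / 2 * N) := by
    simp only [PMF.bind_apply]
    rw [← Summable.tsum_finsetSum fun _ _ => ENNReal.summable]
    refine (ENNReal.tsum_le_tsum hpt).trans ?_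
    rw [ENNReal.tsum_add, ENNReal.tsum_mul_right, ENNReal.tsum_mul_right]
    refine add_le_add (mul_le_mul_left ?_ _) (mul_le_mul_left ?_ _)
    · rw [Summable.tsum_finsetSum fun _ _ => ENNReal.summable]
      refine le_trans ?_ (ENNReal.ofReal_le_ofReal hexp)
      rw [ENNReal.ofReal_sum_of_nonneg fun ω _ => Finset.sum_nonneg fun ω' _ => (Real.exp_pos _).le]
      refine Finset.sum_le_sum fun ω _ => ?_
      rw [ENNReal.ofReal_sum_of_nonneg fun ω' _ => (Real.exp_pos _).le,
        Summable.tsum_finsetSum fun _ _ => ENNReal.summable]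
      exact Finset.sum_le_sum fun ω' _ =>
        P.tsum_messages_mul_le hρ hρ1 (hv ω) (hv ω') (hv0 ω) (hv0 ω')
    · have := bind_false_le_of_lt_bind_true Q T h0
      rwa [PMF.bind_apply] at this
  -- The upper bound is `N / 5 + 5 * N / 24`, which is below `121 / 144 * N`.
  have hcontra := hlow.trans hup
  rw [← ENNReal.ofReal_mul (by positivity), ← ENNReal.ofReal_mul (by norm_num),
    ← ENNReal.ofReal_add (by positivity) (by positivity),
    ENNReal.ofReal_le_ofReal_iff (by positivity)] at hcontra
  have : 2 * N ^ 2 * (1 / (10 * N)) = N / 5 := by field_simp; norm_num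
  linarith

end PrivateCoinProtocol

/-! ### The regimes of small and large `k` -/

theorem Matrix.dotProduct_mulVec_le_of_abs_le {ι : Type*} [Fintype ι] {M : Matrix ι ι ℝ} {a : ℝ}
    (hM : ∀ x x', |M x x'| ≤ a) (v v' : ι → ℝ) :
    v ⬝ᵥ M.mulVec v' ≤ a * ((∑ x, |v x|) * ∑ x, |v' x|) := by
  rw [Finset.sum_mul_sum]
  simp only [dotProduct, Matrix.mulVec, Finset.mul_sum]
  refine Finset.sum_le_sum fun x _ => Finset.sum_le_sum fun x' _ => (le_abs_self _).trans ?_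
  rw [abs_mul, abs_mul, mul_left_comm]
  exact mul_le_mul_of_nonneg_right (hM x x') (by positivity)

theorem Real.exp_half_le_two : Real.exp (1 / 2) ≤ 2 := by
  have h : Real.exp (1 / 2) * Real.exp (1 / 2) = Real.exp 1 := by rw [← Real.exp_add]; norm_num
  have := Real.exp_one_lt_d9
  nlinarith [Real.exp_pos (1 / 2)]

namespace PrivateCoinProtocol

variable {n k : ℕ} [NeZero k] {𝒴 : Type*} {ρ ε : ℝ}

/-- A single alternative, a mixture of the uniform distribution and a point mass, shows that
`n` is at least of the order of `1 / (ρ ^ 2 * ε ^ 2)`. -/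
theorem not_isUniformityTest_of_mul_le (P : PrivateCoinProtocol n k (ldpChannels k 𝒴 ρ))
    (T : (Fin n → 𝒴) → PMF Bool) (hρ : 0 < ρ) (hρ1 : ρ ≤ 1) (hε : 0 < ε)
    (hεk : ε < 1 - 1 / (k : ℝ)) (hn : n * ρ ^ 2 * ε ^ 2 ≤ 1 / 512) :
    ¬ P.IsUniformityTest T ε := by
  have hk : (0 : ℝ) < k := Nat.cast_pos.2 (NeZero.pos k)
  have hεk' : ε * k < k - 1 := by
    have := mul_lt_mul_of_pos_right hεk hk
    rwa [sub_mul, one_div_mul_cancel hk.ne', one_mul] at this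
  have hk2 : (2 : ℝ) ≤ k := by
    have h1 : (1 : ℝ) < k := by nlinarith
    exact_mod_cast Nat.succ_le_of_lt (Nat.one_lt_cast.1 h1)
  -- The distance to uniform is `t * (k - 1) / k`. It exceeds `ε` by `hεk` if `t = 1`, and by `k ≥
  -- 2` if `t = 4 * ε`.
  set t := min 1 (4 * ε) with ht
  have ht0 : 0 < t := lt_min one_pos (by linarith)
  have ht1 : t ≤ 1 := min_le_left _ _
  have ht4 : t ≤ 4 * ε := min_le_right _ _
  have htε : ε * k < t * (k - 1) := by
    rcases min_choice 1 (4 * ε) with h | h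
    · rw [ht, h]; linarith
    · rw [ht, h]; nlinarith
  let v : Fin k → ℝ := fun x => t * (if x = 0 then (k : ℝ) - 1 else -1)
  have habs : ∑ x, |v x| = 2 * (t * (k - 1)) := by
    have : ∀ x, |v x| = t * (1 + if x = 0 then (k : ℝ) - 2 else 0) := by
      intro x
      simp only [v, abs_mul, abs_of_pos ht0]
      split_ifs
      · rw [abs_of_nonneg (by linarith)]; ring
      · simp
    simp only [this, ← Finset.mul_sum, Finset.sum_add_distrib]
    simp
    ring
  have hsum : ∑ x, v x = 0 := by
    have : ∀ x, v x = t * (-1 + if x = 0 then (k : ℝ) else 0) := by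
      intro x
      simp only [v]
      split_ifs <;> ring
    simp only [this, ← Finset.mul_sum, Finset.sum_add_distrib]
    simp
  refine P.not_isUniformityTest (Ω := Unit) T hρ hρ1 (fun _ => v) (fun _ x => ?_) (fun _ => hsum)
    ?_ ?_
  · simp only [v]
    split_ifs <;> nlinarith
  · have : IsEmpty {_ω : Unit // ¬ 2 * ε * k < ∑ x, |v x|} :=
      ⟨fun ω => ω.2 (by rw [habs]; linarith)⟩
    rw [Nat.card_of_isEmpty]
    simp
  · simp only [Finset.univ_unique, Finset.sum_singleton, Fintype.card_unit, Nat.cast_one, one_pow,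
      mul_one]
    refine (Real.exp_le_exp.2 ?_).trans Real.exp_half_le_two
    have h1 := Matrix.dotProduct_mulVec_le_of_abs_le (P.abs_infoMatrix_le hρ hρ1) v v
    rw [habs] at h1
    have h2 : t * (k - 1) ≤ 4 * ε * k :=
      mul_le_mul ht4 (by linarith) (by linarith) (by linarith)
    have h3 : (t * (k - 1)) * (t * (k - 1)) ≤ (4 * ε * k) * (4 * ε * k) :=
      mul_self_le_mul_self (mul_nonneg ht0.le (by linarith)) h2
    rw [one_div_mul_eq_div, div_le_iff₀ (by positivity)]
    calc _ ≤ _ := h1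
      _ = 16 * (n * ρ ^ 2) * ((t * (k - 1)) * (t * (k - 1))) := by ring
      _ ≤ 16 * (n * ρ ^ 2) * ((4 * ε * k) * (4 * ε * k)) := by gcongr
      _ = 256 * (n * ρ ^ 2 * ε ^ 2) * k ^ 2 := by ring
      _ ≤ 1 / 2 * k ^ 2 := by gcongr; linarith

/-- The alternatives of `exists_prior`, which are adapted to the protocol, show that `n` is at least
of the order of `k ^ (3 / 2) / (ρ ^ 2 * ε ^ 2)` when `k` is large. -/
theorem not_isUniformityTest_of_mul_le_rpow {g B T₀ c : ℝ}
    (P : PrivateCoinProtocol n k (ldpChannels k 𝒴 ρ)) (T : (Fin n → 𝒴) → PMF Bool) (hρ : 0 < ρ)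
    (hρ1 : ρ ≤ 1) (hε : 0 < ε) (hg : 0 < g) (hg1 : g ≤ 1 / 2) (hεg : ε ≤ 1 - g)
    (hk : 16 / g ≤ k) (hB : B = 4 / g + g / 4) (hT : T₀ = 12 * B ^ 2 / (g / 16)) (hT1 : 1 ≤ T₀)
    (hc : c = (g / 16) ^ 2 / (512 * B * T₀))
    (hn : n * ρ ^ 2 * ε ^ 2 ≤ c * (k : ℝ) ^ (3 / 2 : ℝ)) : ¬ P.IsUniformityTest T ε := by
  have hk0 : (0 : ℝ) < k := Nat.cast_pos.2 (NeZero.pos k)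
  have hB0 : 0 < B := by rw [hB]; positivity
  have hc0 : 0 < c := by rw [hc]; positivity
  have hκ0 : 0 < (k : ℝ) ^ (3 / 2 : ℝ) := Real.rpow_pos_of_pos hk0 _
  have hκ : ((k : ℝ) ^ (3 / 2 : ℝ)) ^ 2 = (k : ℝ) ^ 3 := by
    rw [← Real.rpow_natCast, ← Real.rpow_mul hk0.le, ← Real.rpow_natCast]
    norm_num
  set κ := (k : ℝ) ^ (3 / 2 : ℝ)
  -- The threshold at which the trace bound leaves at most `g / 16 * k` eigenvalues above `τ`.
  set τ := 4 * (c * κ / ε ^ 2) / (g / 16) with hτ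
  have hτ0 : 0 < τ := by positivity
  have hn' : n * ρ ^ 2 ≤ c * κ / ε ^ 2 := by rwa [le_div_iff₀ (by positivity)]
  obtain ⟨Ω, _, _, v, hv, hv0, hfar, hexp⟩ := exists_prior hg hg1 hτ0
    (P.posSemidef_infoMatrix hρ hρ1) (by rwa [Fintype.card_fin])
    ((P.trace_infoMatrix_le hρ hρ1).trans (by
      rw [Fintype.card_fin, hτ, mul_comm (g / 16), mul_assoc, mul_div_cancel₀ _ (by positivity)]
      gcongr)) hB hT
  rw [Fintype.card_fin] at hfar hexp
  -- Rescaling turns the threshold `2 * (1 - g) * k` into `2 * ε * k`; `t ≤ 1` preserves the lower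
  -- bound `-1`.
  set t := ε / (1 - g) with ht
  have hg' : 0 < 1 - g := by linarith
  have ht0 : 0 < t := by positivity
  have ht1 : t ≤ 1 := (div_le_one hg').2 hεg
  have ht2 : t ≤ 2 * ε := by rw [ht, div_le_iff₀ hg']; nlinarith
  have htε : t * (1 - g) = ε := div_mul_cancel₀ _ hg'.ne'
  refine P.not_isUniformityTest T hρ hρ1 (fun ω => t • v ω) (fun ω x => ?_) (fun ω => ?_) ?_ ?_
  · have := hv ω x
    simp only [Pi.smul_apply, smul_eq_mul]
    nlinarith
  · simp only [Pi.smul_apply, smul_eq_mul, ← Finset.mul_sum, hv0, mul_zero]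
  · have h : ∀ ω, (2 * ε * k < ∑ x, |(t • v ω) x|) ↔ 2 * (1 - g) * k < ∑ x, |v ω x| := by
      intro ω
      simp only [Pi.smul_apply, smul_eq_mul, abs_mul, abs_of_pos ht0, ← Finset.mul_sum]
      rw [← mul_lt_mul_iff_right₀ ht0 (b := 2 * (1 - g) * k), ← htε]
      ring_nf
    simpa only [h] using hfar
  · have h : ∀ ω ω', 1 / (k : ℝ) ^ 2 * ((t • v ω) ⬝ᵥ P.infoMatrix.mulVec (t • v ω')) =
        t ^ 2 / k ^ 2 * (v ω ⬝ᵥ P.infoMatrix.mulVec (v ω')) := by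
      intro ω ω'
      rw [Matrix.mulVec_smul, smul_dotProduct, dotProduct_smul, smul_eq_mul, smul_eq_mul]
      ring
    simp only [h]
    refine (hexp _).trans ?_
    rw [mul_comm]
    gcongr
    refine (Real.exp_le_exp.2 ?_).trans Real.exp_half_le_two
    gcongr
    have ht4 : t ^ 4 ≤ (2 * ε) ^ 4 := pow_le_pow_left₀ ht0.le ht2 4
    calc T₀ * ((t ^ 2 / k ^ 2) ^ 2 * (τ ^ 2 * (B ^ 2 * k)))
        = t ^ 4 * (T₀ * (τ ^ 2 * (B ^ 2 * k)) / k ^ 4) := by ring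
      _ ≤ (2 * ε) ^ 4 * (T₀ * (τ ^ 2 * (B ^ 2 * k)) / k ^ 4) := by gcongr
      _ = 256 * T₀ * B ^ 2 * c ^ 2 / (g / 16) ^ 2 * (κ ^ 2 / k ^ 3) := by
          rw [hτ]
          field_simp
          norm_num
      _ = (g / 16) ^ 2 / (1024 * T₀) := by
          rw [hκ, div_self (by positivity), hc]
          field_simp
          norm_num
      _ ≤ 1 := by
          rw [div_le_one (by positivity)]
          nlinarith

end PrivateCoinProtocol

/-- If no test exists the infimum is `⊤`; otherwise it is attained, by well-ordering. -/
theorem le_privateCoinSampleComplexity {k : ℕ} [NeZero k] {𝒴 : Type*} {𝒲 : Set (Channel k 𝒴)}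
    {ε b : ℝ} (h : ∀ (n : ℕ) (P : PrivateCoinProtocol n k 𝒲) (T : (Fin n → 𝒴) → PMF Bool),
      P.IsUniformityTest T ε → b ≤ n) :
    ENNReal.ofReal b ≤ (privateCoinSampleComplexity 𝒲 ε : ℝ≥0∞) := by
  unfold privateCoinSampleComplexity
  set S := {N : ℕ∞ | ∃ n : ℕ, N = n ∧ ∃ (P : PrivateCoinProtocol n k 𝒲)
    (T : (Fin n → 𝒴) → PMF Bool), P.IsUniformityTest T ε}
  rcases S.eq_empty_or_nonempty with hS | hS
  · simp [hS]
  · obtain ⟨n, hn, P, T, hPT⟩ := csInf_mem hS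
    rw [hn, ENat.toENNReal_coe, ← ENNReal.ofReal_natCast]
    exact ENNReal.ofReal_le_ofReal (h n P T hPT)

theorem mainTheorem9 (ε₀ : ℝ) (hε₀ : ε₀ < 1) :
    ∃ c : ℝ, 0 < c ∧ ∀ (𝒴 : Type*) (k : ℕ) [NeZero k] (ρ ε : ℝ),
      0 < ρ → ρ ≤ 1 → 0 < ε → ε ≤ ε₀ → ε < 1 - 1 / (k : ℝ) →
        ENNReal.ofReal (c * ((k : ℝ) ^ (3 / 2 : ℝ) / (ρ ^ 2 * ε ^ 2))) ≤
          (privateCoinSampleComplexity (ldpChannels k 𝒴 ρ) ε : ℝ≥0∞) := by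
  obtain ⟨g, hg, hg1, hgε⟩ : ∃ g : ℝ, 0 < g ∧ g ≤ 1 / 2 ∧ g ≤ 1 - ε₀ :=
    ⟨min (1 / 2) (1 - ε₀), lt_min (by norm_num) (by linarith), min_le_left _ _, min_le_right _ _⟩
  obtain ⟨B, hB⟩ : ∃ B, B = 4 / g + g / 4 := ⟨_, rfl⟩
  obtain ⟨T₀, hT⟩ : ∃ T₀, T₀ = 12 * B ^ 2 / (g / 16) := ⟨_, rfl⟩
  -- Small enough for both regimes: `c * (16 / g) ^ 2 ≤ 1 / 512` for `k < 16 / g`, and a correlation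
  -- exponent of at most `1 / 2` for larger `k`.
  obtain ⟨c, hc⟩ : ∃ c, c = (g / 16) ^ 2 / (512 * B * T₀) := ⟨_, rfl⟩
  have hB1 : 1 ≤ B := by
    have : 1 ≤ 4 / g := by rw [le_div_iff₀ hg]; linarith
    linarith
  have hT1 : 1 ≤ T₀ := by
    rw [hT, le_div_iff₀ (by positivity)]
    nlinarith
  have hc0 : 0 < c := by rw [hc]; positivity
  refine ⟨c, hc0, fun 𝒴 k _ ρ ε hρ hρ1 hε hεε₀ hεk => ?_⟩
  refine le_privateCoinSampleComplexity fun n P T hPT => ?_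
  by_contra hlt
  rw [not_le, ← mul_div_assoc, lt_div_iff₀ (by positivity), ← mul_assoc] at hlt
  by_cases hk : 16 / g ≤ k
  · exact P.not_isUniformityTest_of_mul_le_rpow T hρ hρ1 hε hg hg1 (by linarith) hk hB hT hT1 hc
      hlt.le hPT
  · refine P.not_isUniformityTest_of_mul_le T hρ hρ1 hε hεk (hlt.le.trans ?_) hPT
    have hk1 : (1 : ℝ) ≤ k := Nat.one_le_cast.2 (NeZero.pos k)
    have h1 : (k : ℝ) ^ (3 / 2 : ℝ) ≤ (16 / g) ^ 2 := by
      calc (k : ℝ) ^ (3 / 2 : ℝ) ≤ (k : ℝ) ^ (2 : ℝ) :=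
            Real.rpow_le_rpow_of_exponent_le hk1 (by norm_num)
        _ = (k : ℝ) ^ 2 := by norm_num
        _ ≤ _ := pow_le_pow_left₀ (by linarith) (not_le.1 hk).le 2
    calc c * (k : ℝ) ^ (3 / 2 : ℝ) ≤ c * (16 / g) ^ 2 := by gcongr
      _ = 1 / (512 * (B * T₀)) := by rw [hc]; field_simp
      _ ≤ 1 / 512 := by
        refine one_div_le_one_div_of_le (by norm_num) ?_
        nlinarith
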